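/- Let $n\ge 2$ and write points of $\mathbb{R}^n$ as $(x_1,x_2,\mathbf y)$ with $\mathbf y=(x_3,\dots,x_n)\in\mathbb{R}^{n-2}$. Let $D\subset\mathbb{R}^m$ be compact, let $H=H(x_1,x_2,\mathbf y)$ be a $C^\infty$ function on $\mathbb{R}^n$, and for $k=1,2,3,4$ let $g^k=(g^k_1,\dots,g^k_n)$ be $C^\infty$ functions of $(x_1,x_2,\mathbf y)\in\mathbb{R}^n$ depending on a parameter $\delta\in D$. For $\varepsilon\ge 0$ consider the piecewise smooth system $$\dot x_1=H_{x_2}+\varepsilon g^k_1,\qquad \dot x_2=-H_{x_1}+\varepsilon g^k_2,\qquad \dot x_i=\varepsilon g^k_i\quad(3\le i\le n),\qquad (x_1,x_2)\in Q^k,$$ $$Q^1=\{x_1\ge0,x_2\ge0\},\quad Q^2=\{x_1>0,x_2<0\},\quad Q^3=\{x_1<0,x_2<0\},\quad Q^4=\{x_1<0,x_2>0\}.$$ Assume: (H1) There are an open set $G_1\subset\mathbb{R}^{n-2}$ and, for each $\hat h\in G_1$, an open interval $J_{\hat h}$ such that for each $\hat h\in G_1$, $h_1\in J_{\hat h}$,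 with $h=(h_1,\hat h)$, the sets $$L^k_{h_1,\hat h}=\{(x_1,x_2)\in Q^k: H(x_1,x_2,\hat h)=h_1\},\qquad k=1,2,3,4,$$ contain no critical points of the planar system $\dot x_1=H_{x_2}(x_1,x_2,\hat h)$, $\dot x_2=-H_{x_1}(x_1,x_2,\hat h)$; and there are points $A(h)$, $B(h)$, $C(h)$, $E(h)$ on the positive $x_2$-axis, the positive $x_1$-axis, the negative $x_2$-axis and the negative $x_1$-axis, respectively, such that $L^1_{h_1,\hat h}$, $L^2_{h_1,\hat h}$, $L^3_{h_1,\hat h}$, $L^4_{h_1,\hat h}$ are (up to end points not belonging to $Q^k$) orbital arcs of this planar system from $A(h)$ to $B(h)$, from $B(h)$ to $C(h)$, from $C(h)$ to $E(h)$ and from $E(h)$ to $A(h)$, respectively, each meeting the coordinate axes only at its end points. (H2) For all $\hat h\in G_1$, $h_1\in J_{\hat h}$, $$H_{x_2}(A(h),\hat h)\,H_{x_2}(C(h),\hat h)\,H_{x_1}(B(h),\hat h)\,H_{x_1}(E(h),\hat h)\ne0 .$$ Let $\mathbf H=(H,x_3,\dots,x_n)^T$, and for small $\varepsilon\ge0$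 let $A_\varepsilon(h,\delta)$ be the image of $(A(h),\hat h)$ under the Poincaré map: the orbit of the first subsystem from $(A(h),\hat h)$ runs through the open quadrant $x_1>0,x_2>0$ to its first intersection $B_\varepsilon$ with $\{x_2=0\}$, that of the second from $B_\varepsilon$ through $x_1>0,x_2<0$ to its first intersection $C_\varepsilon$ with $\{x_1=0\}$, that of the third from $C_\varepsilon$ through $x_1<0,x_2<0$ to its first intersection $E_\varepsilon$ with $\{x_2=0\}$, and that of the fourth from $E_\varepsilon$ through $x_1<0,x_2>0$ to its first intersection $A_\varepsilon$ with $\{x_1=0\}$. The first order Melnikov vector is $M(h,\delta)=F(h,0,\delta)$, where $\mathbf H(A_\varepsilon(h,\delta))-\mathbf H(A(h),\hat h)=\varepsilon F(h,\varepsilon,\delta)$ with $F$ continuous in $\varepsilon$ at $\varepsilon=0$. Then for all $\hat h\in G_1$, $h_1\in J_{\hat h}$ and $\delta\in D$, the point $A_\varepsilon(h,\delta)$ exists and is unique for all sufficiently small $\varepsilon\ge0$, the vector $M(h,\delta)$ exists, and $$M(h,\delta)=\Big(\sum_{k=1}^4\big(M^k_1+N_k\big),\ \sum_{k=1}^4M^k_2,\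 \dots,\ \sum_{k=1}^4M^k_{n-1}\Big)^T,$$ where $$M^k_1=\int_{L^k_{h_1,\hat h}}g^k_2(x_1,x_2,\hat h,\delta)\,dx_1-g^k_1(x_1,x_2,\hat h,\delta)\,dx_2,$$ $$N_k=\sum_{i=1}^{n-2}\int_{L^k_{h_1,\hat h}}H_{x_{i+2}}(x_1,x_2,\hat h)\,g^k_{i+2}(x_1,x_2,\hat h,\delta)\,dt,$$ $$M^k_j=\int_{L^k_{h_1,\hat h}}g^k_{j+1}(x_1,x_2,\hat h,\delta)\,dt,\qquad j=2,\dots,n-1,$$ the arcs being oriented and parametrized by the time $t$ of the planar system. -/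

import Mathlib

open Set Filter Topology

open scoped ContDiff

noncomputable section

namespace NearHamiltonian

/-- The phase space `ℝⁿ`, `n = d + 2`, with points `(x₁, x₂, y)`, `y = (x₃, …, xₙ) ∈ ℝᵈ`. -/
abbrev Phase (d : ℕ) : Type := ℝ × ℝ × (Fin d → ℝ)

variable {d : ℕ}

/-- `H_{x₁}`. -/
def dx1 (H : Phase d → ℝ) (x : Phase d) : ℝ :=
  deriv (fun s => H (s, x.2.1, x.2.2)) x.1

/-- `H_{x₂}`. -/
def dx2 (H : Phase d → ℝ) (x : Phase d) : ℝ :=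
  deriv (fun s => H (x.1, s, x.2.2)) x.2.1

/-- `H_{x_{i+2}}` for `i = 1, …, n - 2` (here `i : Fin d` counts from `0`). -/
def dy (H : Phase d → ℝ) (i : Fin d) (x : Phase d) : ℝ :=
  deriv (fun s => H (x.1, x.2.1, Function.update x.2.2 i s)) (x.2.2 i)

/-- The regions of definition of the four subsystems, in clockwise order. -/
def region : Fin 4 → Set (ℝ × ℝ) :=
  ![{p | 0 ≤ p.1 ∧ 0 ≤ p.2}, {p | 0 < p.1 ∧ p.2 < 0},
    {p | p.1 < 0 ∧ p.2 < 0}, {p | p.1 < 0 ∧ 0 < p.2}]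

/-- The four open quadrants, in the same order. -/
def openQuadrant : Fin 4 → Set (ℝ × ℝ) :=
  ![{p | 0 < p.1 ∧ 0 < p.2}, {p | 0 < p.1 ∧ p.2 < 0},
    {p | p.1 < 0 ∧ p.2 < 0}, {p | p.1 < 0 ∧ 0 < p.2}]

/-- The switching plane through which a clockwise orbit leaves the `k`-th quadrant:
`x₂ = 0`, `x₁ = 0`, `x₂ = 0`, `x₁ = 0`. -/
def exitPlane : Fin 4 → Set (Phase d) :=
  ![{x | x.2.1 = 0}, {x | x.1 = 0}, {x | x.2.1 = 0}, {x | x.1 = 0}]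

/-- The right-hand side of the near-Hamiltonian system
`ẋ₁ = H_{x₂} + ε g₁`, `ẋ₂ = -H_{x₁} + ε g₂`, `ẏ = ε (g₃, …, gₙ)`. -/
def vectorField (H : Phase d → ℝ) (g : Phase d → Phase d) (ε : ℝ) (x : Phase d) : Phase d :=
  (dx2 H x, -dx1 H x, 0) + ε • g x

/-! ### The unperturbed planar system -/

/-- `L^k_{h₁,ĥ}`, the part of the level set `H(·,·,ĥ) = h₁` in the `k`-th region. As all four
Hamiltonians are equal, the four levels `h₁`, `H(B(h),ĥ)`, `H(C(h),ĥ)`, `H(E(h),ĥ)` coincide. -/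
def levelArc (H : Phase d → ℝ) (h₁ : ℝ) (hhat : Fin d → ℝ) (k : Fin 4) : Set (ℝ × ℝ) :=
  {p | p ∈ region k ∧ H (p.1, p.2, hhat) = h₁}

/-- `γ : [0,T] → ℝ²` is a solution of `ẋ₁ = H_{x₂}(x₁,x₂,ĥ)`, `ẋ₂ = -H_{x₁}(x₁,x₂,ĥ)` from `p` to
`q`, meeting the coordinate axes only at its two end points, and traversing `L^k_{h₁,ĥ}`
(for the open regions, `L^k_{h₁,ĥ}` does not contain the end points of the arc). -/
structure IsOrbitalArc (H : Phase d → ℝ) (h₁ : ℝ) (hhat : Fin d → ℝ) (k : Fin 4)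
    (p q : ℝ × ℝ) (T : ℝ) (γ : ℝ → ℝ × ℝ) : Prop where
  pos : 0 < T
  start : γ 0 = p
  finish : γ T = q
  solves : ∀ t ∈ Icc 0 T, HasDerivWithinAt γ
    (dx2 H ((γ t).1, (γ t).2, hhat), -dx1 H ((γ t).1, (γ t).2, hhat)) (Icc 0 T) t
  inside : ∀ t ∈ Ioo 0 T, γ t ∈ openQuadrant k
  image : γ '' Icc 0 T ∩ region k = levelArc H h₁ hhat k

/-- Assumption (H1). The vertices are `V 0 = A`, `V 1 = B`, `V 2 = C`, `V 3 = E`, as functions of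
`h = (h₁, ĥ)`; the `k`-th arc runs from `V k` to `V (k + 1)`, where `3 + 1 = 0` in `Fin 4`. -/
structure HypH1 (H : Phase d → ℝ) (G₁ : Set (Fin d → ℝ)) (J : (Fin d → ℝ) → Set ℝ)
    (V : Fin 4 → ℝ → (Fin d → ℝ) → ℝ × ℝ) : Prop where
  isOpen_G₁ : IsOpen G₁
  isOpen_J : ∀ hhat ∈ G₁, IsOpen (J hhat)
  interval_J : ∀ hhat ∈ G₁, (J hhat).OrdConnected
  vertexA : ∀ hhat ∈ G₁, ∀ h₁ ∈ J hhat, (V 0 h₁ hhat).1 = 0 ∧ 0 < (V 0 h₁ hhat).2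
  vertexB : ∀ hhat ∈ G₁, ∀ h₁ ∈ J hhat, 0 < (V 1 h₁ hhat).1 ∧ (V 1 h₁ hhat).2 = 0
  vertexC : ∀ hhat ∈ G₁, ∀ h₁ ∈ J hhat, (V 2 h₁ hhat).1 = 0 ∧ (V 2 h₁ hhat).2 < 0
  vertexE : ∀ hhat ∈ G₁, ∀ h₁ ∈ J hhat, (V 3 h₁ hhat).1 < 0 ∧ (V 3 h₁ hhat).2 = 0
  noCritical : ∀ hhat ∈ G₁, ∀ h₁ ∈ J hhat, ∀ k, ∀ p ∈ levelArc H h₁ hhat k,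
    ¬ (dx1 H (p.1, p.2, hhat) = 0 ∧ dx2 H (p.1, p.2, hhat) = 0)
  arcs : ∀ hhat ∈ G₁, ∀ h₁ ∈ J hhat, ∀ k, ∃ T γ,
    IsOrbitalArc H h₁ hhat k (V k h₁ hhat) (V (k + 1) h₁ hhat) T γ

/-- Assumption (H2): `H_{x₂}(A) H_{x₂}(C) H_{x₁}(B) H_{x₁}(E) ≠ 0`. -/
def HypH2 (H : Phase d → ℝ) (G₁ : Set (Fin d → ℝ)) (J : (Fin d → ℝ) → Set ℝ)
    (V : Fin 4 → ℝ → (Fin d → ℝ) → ℝ × ℝ) : Prop :=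
  ∀ hhat ∈ G₁, ∀ h₁ ∈ J hhat,
    dx2 H ((V 0 h₁ hhat).1, (V 0 h₁ hhat).2, hhat) *
    dx2 H ((V 2 h₁ hhat).1, (V 2 h₁ hhat).2, hhat) *
    dx1 H ((V 1 h₁ hhat).1, (V 1 h₁ hhat).2, hhat) *
    dx1 H ((V 3 h₁ hhat).1, (V 3 h₁ hhat).2, hhat) ≠ 0

/-! ### The Poincaré map and the Melnikov vector of the perturbed system -/

/-- The orbit of the `k`-th subsystem starting at `p` runs through the `k`-th open quadrant
until it meets the exit plane for the first time, at `q`. -/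
def IsFirstHit (H : Phase d → ℝ) (g : Fin 4 → Phase d → Phase d) (ε : ℝ) (k : Fin 4)
    (p q : Phase d) : Prop :=
  ∃ (T : ℝ) (φ : ℝ → Phase d), 0 < T ∧ φ 0 = p ∧ φ T = q ∧
    (∀ t ∈ Icc 0 T, HasDerivWithinAt φ (vectorField H (g k) ε (φ t)) (Icc 0 T) t) ∧
    (∀ t ∈ Ioo 0 T, ((φ t).1, (φ t).2.1) ∈ openQuadrant k) ∧
    q ∈ exitPlane k

/-- `a'` is the image of `a` under the Poincaré map, through points `b = B_ε`, `c = C_ε`,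
`e = E_ε` on the switching planes. -/
def IsPoincareImage (H : Phase d → ℝ) (g : Fin 4 → Phase d → Phase d) (ε : ℝ)
    (a a' : Phase d) : Prop :=
  ∃ b c e : Phase d, IsFirstHit H g ε 0 a b ∧ IsFirstHit H g ε 1 b c ∧
    IsFirstHit H g ε 2 c e ∧ IsFirstHit H g ε 3 e a'

/-- The vector `(H, x₃, …, xₙ)` of first integrals of the unperturbed system. -/
def firstIntegrals (H : Phase d → ℝ) (x : Phase d) : ℝ × (Fin d → ℝ) := (H x, x.2.2)

/-- `M` is the first order Melnikov vector of the perturbed system at the orbit through `a`: for all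
small `ε ≥ 0` the Poincaré image `A_ε` of `a` exists and is unique, and
`𝐇(A_ε) - 𝐇(a) = ε F(ε)` with `F` continuous at `0` and `M = F(0)`. -/
def IsMelnikovVector (H : Phase d → ℝ) (g : Fin 4 → Phase d → Phase d) (a : Phase d)
    (M : ℝ × (Fin d → ℝ)) : Prop :=
  ∃ ε₀ > 0, ∃ (A : ℝ → Phase d) (F : ℝ → ℝ × (Fin d → ℝ)),
    (∀ ε ∈ Ico 0 ε₀, ∀ a', IsPoincareImage H g ε a a' ↔ a' = A ε) ∧
    (∀ ε ∈ Ico 0 ε₀, firstIntegrals H (A ε) - firstIntegrals H a = ε • F ε) ∧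
    ContinuousWithinAt F (Ici 0) 0 ∧ M = F 0

/-! ### Integrals along an arc `γ : [0,T] → ℝ²` -/

/-- `∫_γ u dx₁ + v dx₂`. -/
def lineIntegral (u v : ℝ × ℝ → ℝ) (T : ℝ) (γ : ℝ → ℝ × ℝ) : ℝ :=
  ∫ t in (0 : ℝ)..T,
    (u (γ t) * deriv (fun s => (γ s).1) t + v (γ t) * deriv (fun s => (γ s).2) t)

/-- `∫_γ u dt`, for `γ` parametrized by the time `t`. -/
def timeIntegral (u : ℝ × ℝ → ℝ) (T : ℝ) (γ : ℝ → ℝ × ℝ) : ℝ :=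
  ∫ t in (0 : ℝ)..T, u (γ t)

/-- `M₁ᵏ = ∫ g₂ dx₁ - g₁ dx₂`. -/
def M1 (g : Phase d → Phase d) (hhat : Fin d → ℝ) (T : ℝ) (γ : ℝ → ℝ × ℝ) : ℝ :=
  lineIntegral (fun p => (g (p.1, p.2, hhat)).2.1) (fun p => -(g (p.1, p.2, hhat)).1) T γ

/-- `N_k = ∑ᵢ ∫ H_{x_{i+2}} g_{i+2} dt`. -/
def N (H : Phase d → ℝ) (g : Phase d → Phase d) (hhat : Fin d → ℝ) (T : ℝ)
    (γ : ℝ → ℝ × ℝ) : ℝ :=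
  ∑ i : Fin d,
    timeIntegral (fun p => dy H i (p.1, p.2, hhat) * (g (p.1, p.2, hhat)).2.2 i) T γ

/-- `M_jᵏ = ∫ g_{j+1} dt` for `j = 2, …, n - 1` (here `j = i + 2` with `i : Fin d`). -/
def Mj (g : Phase d → Phase d) (hhat : Fin d → ℝ) (i : Fin d) (T : ℝ) (γ : ℝ → ℝ × ℝ) : ℝ :=
  timeIntegral (fun p => (g (p.1, p.2, hhat)).2.2 i) T γ

end NearHamiltonian

end

/-! For `ε = 0` the functions `H, x₃, …, xₙ` are first integrals. Along an orbit of a perturbed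
subsystem the terms `H_{x₁} H_{x₂}` cancel, so `(H, x₃, …, xₙ)` changes by exactly `ε` times the
integral of `fluxDensity` along that orbit (`firstIntegrals_sub_eq`). After division by `ε` only a
limit remains: the integral over the perturbed orbit tends to that over the unperturbed arc. There
`dx₁ = H_{x₂} dt` and `dx₂ = -H_{x₁} dt`, so the planar part of the flux becomes `g₂ dx₁ - g₁ dx₂`
(`integral_fluxDensity_eq`).

The limit requires that perturbed orbits cross each quadrant like the arc does. By (H2) the arc
meets the axes transversally. Grönwall's inequality keeps nearby orbits close to it, monotonicity of
a coordinate controls them near both ends, and compactness controls them in between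
(`exists_hit_of_perturbation`). Each passage is stated for all starting points near a vertex on the
entry plane, so four passages compose. Uniqueness of the image is uniqueness for the differential
equation (`isFirstHit_unique`). -/

namespace NearHamiltonian

/-! ### Extension of solutions and their dependence on a perturbation. -/

section Flow

variable {E : Type*} [NormedAddCommGroup E] [NormedSpace ℝ E]

/-- A derivative within `[0, S]` is a right derivative at every point of `[0, S)`. -/
theorem hasDerivWithinAt_Ici_of_Icc {F : Type*} [NormedAddCommGroup F] [NormedSpace ℝ F]
    {φ : ℝ → F} {φ' : F} {S t : ℝ} (ht : t ∈ Ico 0 S)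
    (h : HasDerivWithinAt φ φ' (Icc 0 S) t) : HasDerivWithinAt φ φ' (Ici t) t :=
  h.mono_of_mem_nhdsWithin (Icc_mem_nhdsGE_of_mem ht)

theorem exists_solution_of_lipschitz_of_bounded [CompleteSpace E] {v : E → E} {K : NNReal}
    (hv : LipschitzWith K v) {C : ℝ} (hC : ∀ x, ‖v x‖ ≤ C) {S : ℝ} (hS : 0 ≤ S) (p : E) :
    ∃ φ : ℝ → E, φ 0 = p ∧ ∀ t ∈ Icc 0 S, HasDerivWithinAt φ (v (φ t)) (Icc 0 S) t := by
  have hC0 : 0 ≤ C := (norm_nonneg _).trans (hC 0)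
  -- In time `S` a solution of speed at most `C` travels at most `C * S`; this is the radius of the
  -- ball, and no further restriction on `S` is needed.
  have h : IsPicardLindelof (fun _ : ℝ => v) (⟨0, left_mem_Icc.2 hS⟩ : Icc (0 : ℝ) S) p
      (C.toNNReal * S.toNNReal) 0 C.toNNReal K :=
    { lipschitzOnWith := fun _ _ => hv.lipschitzOnWith
      continuousOn := fun _ _ => continuousOn_const
      norm_le := fun _ _ x _ => by simpa [hC0] using hC x
      mul_max_le := by simp [hC0, hS] }
  exact h.exists_eq_forall_mem_Icc_hasDerivWithinAt₀

/-- Solutions of a Lipschitz equation depend continuously on the initial value and on a bounded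
perturbation of the equation. -/
theorem exists_forall_dist_lt_of_lipschitz {v₀ v₁ : E → E} {K : NNReal}
    (hv : LipschitzWith K v₀) {C : ℝ} (hC : ∀ x, ‖v₁ x‖ ≤ C) (S : ℝ) {η : ℝ} (hη : 0 < η) :
    ∃ ρ > 0, ∀ ε ∈ Ico 0 ρ, ∀ Φ φ : ℝ → E,
      (∀ t ∈ Icc 0 S, HasDerivWithinAt Φ (v₀ (Φ t)) (Icc 0 S) t) →
      (∀ t ∈ Icc 0 S, HasDerivWithinAt φ (v₀ (φ t) + ε • v₁ (φ t)) (Icc 0 S) t) →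
      dist (φ 0) (Φ 0) < ρ → ∀ t ∈ Icc 0 S, dist (φ t) (Φ t) < η := by
  have hC0 : 0 ≤ C := (norm_nonneg _).trans (hC 0)
  set B := Real.exp ((K + 1) * S) with hB
  have hBpos : 0 < B := Real.exp_pos _
  have hden : 0 < (1 + C) * B := by positivity
  -- Grönwall bounds the distance by `B * (dist (φ 0) (Φ 0) + ε * C)`, and both `dist (φ 0) (Φ 0)`
  -- and `ε` are less than `ρ`.
  refine ⟨η / ((1 + C) * B), by positivity, fun ε hε Φ φ hΦ hφ h0 t ht => ?_⟩
  -- A constant `K + 1 ≥ 1` avoids the degenerate case of `gronwallBound` and makes division by it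
  -- harmless.
  have hv' : LipschitzWith (K + 1) v₀ := hv.weaken (by simp)
  have key := dist_le_of_approx_trajectories_ODE (v := fun _ => v₀) (εf := ε * C) (εg := 0)
    (fun _ => hv') (fun t ht => (hφ t ht).continuousWithinAt)
    (fun t ht => hasDerivWithinAt_Ici_of_Icc ht (hφ t (Ico_subset_Icc_self ht)))
    (fun t _ => by
      rw [dist_eq_norm, add_sub_cancel_left, norm_smul, Real.norm_of_nonneg hε.1]
      exact mul_le_mul_of_nonneg_left (hC _) hε.1)
    (fun t ht => (hΦ t ht).continuousWithinAt)
    (fun t ht => hasDerivWithinAt_Ici_of_Icc ht (hΦ t (Ico_subset_Icc_self ht)))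
    (fun t _ => by simp) le_rfl t ht
  have hK : (0 : ℝ) < K + 1 := by positivity
  have hKcast : ((K + 1 : NNReal) : ℝ) = K + 1 := by push_cast; rfl
  rw [hKcast, gronwallBound_of_K_ne_0 hK.ne', add_zero, sub_zero] at key
  have hexp : Real.exp ((K + 1) * t) ≤ B :=
    Real.exp_le_exp.2 (mul_le_mul_of_nonneg_left ht.2 hK.le)
  have hexp1 : 1 ≤ Real.exp ((K + 1) * t) := Real.one_le_exp (mul_nonneg hK.le ht.1)
  have hεC : 0 ≤ ε * C := mul_nonneg hε.1 hC0
  have h1 : ε * C / (K + 1) ≤ ε * C :=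
    div_le_self hεC (by simp)
  have h2 : ε * C / (K + 1) * (Real.exp ((K + 1) * t) - 1) ≤ ε * C * B :=
    mul_le_mul h1 (by linarith) (by linarith) hεC
  have h3 : dist (φ 0) (Φ 0) * Real.exp ((K + 1) * t) ≤ dist (φ 0) (Φ 0) * B :=
    mul_le_mul_of_nonneg_left hexp dist_nonneg
  have h4 : dist (φ 0) (Φ 0) * B < η / ((1 + C) * B) * B := mul_lt_mul_of_pos_right h0 hBpos
  have h5 : ε * C * B ≤ η / ((1 + C) * B) * C * B := by
    have := hε.2.le
    gcongr
  have h6 : η / ((1 + C) * B) * B + η / ((1 + C) * B) * C * B = η := by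
    field_simp
  linarith

/-- A solution of a `C¹` equation on `[0, T]` extends to a longer interval, on which it is the
uniform limit of solutions of perturbed equations with nearby initial values. -/
theorem exists_extension_forall_perturbation [FiniteDimensional ℝ E] {v₀ v₁ : E → E}
    (hv₀ : ContDiff ℝ 1 v₀) (hv₁ : ContDiff ℝ 1 v₁) {T : ℝ} (hT : 0 < T) {φ₀ : ℝ → E}
    (hφ₀ : ∀ t ∈ Icc 0 T, HasDerivWithinAt φ₀ (v₀ (φ₀ t)) (Icc 0 T) t) :
    ∃ S > T, ∃ Φ : ℝ → E, EqOn Φ φ₀ (Icc 0 T) ∧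
      (∀ t ∈ Icc 0 S, HasDerivWithinAt Φ (v₀ (Φ t)) (Icc 0 S) t) ∧
      ∀ η > 0, ∃ ρ > 0, ∀ ε ∈ Ico 0 ρ, ∀ p, dist p (φ₀ 0) < ρ →
        ∃ φ : ℝ → E, φ 0 = p ∧
          (∀ t ∈ Icc 0 S, HasDerivWithinAt φ (v₀ (φ t) + ε • v₁ (φ t)) (Icc 0 S) t) ∧
          ∀ t ∈ Icc 0 S, dist (φ t) (Φ t) < η := by
  have : CompleteSpace E := FiniteDimensional.complete ℝ E
  have hφ₀c : ContinuousOn φ₀ (Icc 0 T) := fun t ht => (hφ₀ t ht).continuousWithinAt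
  obtain ⟨R, hR, hφ₀R⟩ := (isCompact_Icc.image_of_continuousOn hφ₀c).isBounded.subset_ball_lt 0 0
  -- Cutting off outside a ball makes both fields globally Lipschitz and bounded. The orbit `Φ`
  -- stays in radius `R` up to time `S`, perturbed orbits stay within `1` of it, and on radius `R +
  -- 1` the cutoff is invisible.
  let χ : ContDiffBump (0 : E) := ⟨R + 1, R + 2, by linarith, by linarith⟩
  have hχ : ∀ x : E, ‖x‖ < R + 1 → χ x = 1 := fun x hx =>
    χ.one_of_mem_closedBall (by simpa using hx.le)
  have hχc : ContDiff ℝ 1 χ := χ.contDiff (n := 1)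
  have hs₀ : HasCompactSupport fun x => χ x • v₀ x := χ.hasCompactSupport.smul_right
  have hs₁ : HasCompactSupport fun x => χ x • v₁ x := χ.hasCompactSupport.smul_right
  obtain ⟨K₀, hK₀⟩ := (hχc.smul hv₀).lipschitzWith_of_hasCompactSupport hs₀ one_ne_zero
  obtain ⟨K₁, hK₁⟩ := (hχc.smul hv₁).lipschitzWith_of_hasCompactSupport hs₁ one_ne_zero
  obtain ⟨C₀, hC₀⟩ := hs₀.exists_bound_of_continuous (hχc.smul hv₀).continuous
  obtain ⟨C₁, hC₁⟩ := hs₁.exists_bound_of_continuous (hχc.smul hv₁).continuous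
  obtain ⟨Φ, hΦ0, hΦ⟩ := exists_solution_of_lipschitz_of_bounded hK₀ hC₀
    (by linarith : (0 : ℝ) ≤ T + 1) (φ₀ 0)
  have hΦc : ContinuousOn Φ (Icc 0 (T + 1)) := fun t ht => (hΦ t ht).continuousWithinAt
  have hsub : Icc 0 T ⊆ Icc 0 (T + 1) := Icc_subset_Icc_right (by linarith)
  have hφ₀norm : ∀ t ∈ Icc 0 T, ‖φ₀ t‖ < R := fun t ht => by
    simpa using hφ₀R (mem_image_of_mem φ₀ ht)
  have heq : EqOn Φ φ₀ (Icc 0 T) := by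
    refine ODE_solution_unique (v := fun _ x => χ x • v₀ x) (fun _ => hK₀) (hΦc.mono hsub)
      (fun t ht => hasDerivWithinAt_Ici_of_Icc ⟨ht.1, by linarith [ht.2]⟩
        (hΦ t (hsub (Ico_subset_Icc_self ht)))) hφ₀c (fun t ht => ?_) hΦ0
    have ht' := Ico_subset_Icc_self ht
    simp only [hχ _ ((hφ₀norm t ht').trans (by linarith)), one_smul]
    exact hasDerivWithinAt_Ici_of_Icc ht (hφ₀ t ht')
  obtain ⟨S, hTS, hS1, hΦS⟩ : ∃ S > T, S ≤ T + 1 ∧ ∀ t ∈ Icc 0 S, ‖Φ t‖ < R := by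
    have hTmem : T ∈ Icc 0 (T + 1) := ⟨hT.le, by linarith⟩
    have hev : ∀ᶠ t in 𝓝[Icc 0 (T + 1)] T, ‖Φ t‖ < R :=
      (hΦc T hTmem).norm.eventually_lt_const (by
        show ‖Φ T‖ < R
        rw [heq (right_mem_Icc.2 hT.le)]
        exact hφ₀norm T (right_mem_Icc.2 hT.le))
    obtain ⟨r, hr, hball⟩ := Metric.mem_nhdsWithin_iff.1 hev
    refine ⟨T + min (r / 2) 1, by simp [hr], by simp, fun t ht => ?_⟩
    rcases le_total t T with h | h
    · rw [heq ⟨ht.1, h⟩]; exact hφ₀norm t ⟨ht.1, h⟩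
    · refine hball ⟨?_, ht.1, ht.2.trans (by simp)⟩
      rw [Metric.mem_ball, Real.dist_eq, abs_of_nonneg (by linarith)]
      have := min_le_left (r / 2) 1
      linarith [ht.2]
  have hsub' : Icc 0 S ⊆ Icc 0 (T + 1) := Icc_subset_Icc_right hS1
  refine ⟨S, hTS, Φ, heq, fun t ht => ?_, fun η hη => ?_⟩
  · have h := (hΦ t (hsub' ht)).mono hsub'
    rwa [hχ _ ((hΦS t ht).trans (by linarith)), one_smul] at h
  obtain ⟨ρ, hρ, hclose⟩ := exists_forall_dist_lt_of_lipschitz hK₀ hC₁ (T + 1)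
    (lt_min hη one_pos)
  refine ⟨ρ, hρ, fun ε hε p hp => ?_⟩
  obtain ⟨φ, hφ0, hφ⟩ := exists_solution_of_lipschitz_of_bounded
    (hK₀.add ((lipschitzWith_smul ε).comp hK₁)) (C := C₀ + ε * C₁)
    (fun x => (norm_add_le _ _).trans (add_le_add (hC₀ x) (by
      simp only [Function.comp, norm_smul ε, Real.norm_of_nonneg hε.1]
      exact mul_le_mul_of_nonneg_left (hC₁ x) hε.1)))
    (by linarith : (0 : ℝ) ≤ T + 1) p
  have hd := hclose ε hε Φ φ hΦ hφ (by rwa [hφ0, hΦ0])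
  refine ⟨φ, hφ0, fun t ht => ?_, fun t ht => (hd t (hsub' ht)).trans_le (min_le_left _ _)⟩
  have h := (hφ t (hsub' ht)).mono hsub'
  have hnorm : ‖φ t‖ < R + 1 := by
    have h1 := (hd t (hsub' ht)).trans_le (min_le_right _ _)
    rw [dist_eq_norm] at h1
    have h2 := norm_le_norm_add_norm_sub (Φ t) (φ t)
    rw [norm_sub_rev] at h2
    linarith [hΦS t ht]
  simpa only [Function.comp, hχ _ hnorm, one_smul] using h

end Flow

/-! ### Transversal passage from one hyperplane to another. -/

section Hitting

variable {E : Type*} [NormedAddCommGroup E] [NormedSpace ℝ E]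

theorem strictMonoOn_comp_of_pos (f : E →L[ℝ] ℝ) {φ φ' : ℝ → E} {S a b : ℝ} (ha : 0 ≤ a)
    (hb : b ≤ S) (hφ : ∀ t ∈ Icc 0 S, HasDerivWithinAt φ (φ' t) (Icc 0 S) t)
    (hpos : ∀ t ∈ Ioo a b, 0 < f (φ' t)) : StrictMonoOn (fun t => f (φ t)) (Icc a b) := by
  have hsub : Icc a b ⊆ Icc 0 S := Icc_subset_Icc ha hb
  refine strictMonoOn_of_deriv_pos (convex_Icc a b)
    (f.continuous.comp_continuousOn fun t ht => ((hφ t (hsub ht)).mono hsub).continuousWithinAt)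
    fun t ht => ?_
  rw [interior_Icc] at ht
  have hmem : t ∈ Icc 0 S := hsub (Ioo_subset_Icc_self ht)
  have hd : HasDerivAt φ (φ' t) t :=
    (hφ t hmem).hasDerivAt (Icc_mem_nhds (ha.trans_lt ht.1) (ht.2.trans_le hb))
  have := f.hasFDerivAt.comp_hasDerivAt t hd
  rw [show deriv (fun t => f (φ t)) t = f (φ' t) from this.deriv]
  exact hpos t ht

/-- If `u` is positive at `x₀` and `w` increases along `v₀` there, then the same holds near `x₀` for
all small perturbations of the field. -/
theorem exists_ball_forall_pos {v₀ v₁ : E → E} (hv₀ : Continuous v₀) (hv₁ : Continuous v₁)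
    (u w : E →L[ℝ] ℝ) {x₀ : E} (hu : 0 < u x₀) (hw : 0 < w (v₀ x₀)) :
    ∃ r > 0, ∀ ε ∈ Ico 0 r, ∀ x, dist x x₀ < r → 0 < u x ∧ 0 < w (v₀ x + ε • v₁ x) := by
  -- With `ε` as an extra variable, one neighbourhood of `(0, x₀)` serves all small perturbations.
  have hc : Continuous fun z : ℝ × E => w (v₀ z.2 + z.1 • v₁ z.2) := by fun_prop
  have hc' : Continuous fun z : ℝ × E => u z.2 := by fun_prop
  have hev : ∀ᶠ z : ℝ × E in 𝓝 (0, x₀), 0 < u z.2 ∧ 0 < w (v₀ z.2 + z.1 • v₁ z.2) :=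
    (hc'.tendsto (0, x₀) |>.eventually_const_lt hu).and
      (hc.tendsto (0, x₀) |>.eventually_const_lt (by simpa using hw))
  obtain ⟨r, hr, hball⟩ := Metric.eventually_nhds_iff.1 hev
  refine ⟨r, hr, fun ε hε x hx => hball (y := (ε, x)) ?_⟩
  rw [Prod.dist_eq]
  refine max_lt ?_ hx
  simpa [abs_of_nonneg hε.1] using hε.2

theorem exists_forall_dist_lt_of_continuousOn {F : Type*} [PseudoMetricSpace F] {Φ : ℝ → F}
    {S T : ℝ} (hΦ : ContinuousOn Φ (Icc 0 S)) (hT : T ∈ Icc 0 S) {r : ℝ} (hr : 0 < r) :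
    ∃ a > 0, ∀ t ∈ Icc 0 S, |t - T| ≤ a → dist (Φ t) (Φ T) < r := by
  obtain ⟨a, ha, h⟩ := Metric.continuousWithinAt_iff.1 (hΦ T hT) r hr
  refine ⟨a / 2, by positivity, fun t ht hta => h ht ?_⟩
  rw [Real.dist_eq]
  linarith

/-- An orbit that runs transversally from the hyperplane `w = 0` through `{u > 0, w > 0}` to the
hyperplane `u = 0` does so together with all nearby orbits of nearby fields. -/
theorem exists_hit_of_close {v₀ v₁ : E → E} (hv₀ : Continuous v₀) (hv₁ : Continuous v₁)
    (u w : E →L[ℝ] ℝ) {T S : ℝ} (hT : 0 < T) (hTS : T < S) {Φ : ℝ → E}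
    (hΦ : ∀ t ∈ Icc 0 S, HasDerivWithinAt Φ (v₀ (Φ t)) (Icc 0 S) t)
    (hu0 : 0 < u (Φ 0)) (hw0 : 0 < w (v₀ (Φ 0))) (huT : u (Φ T) = 0)
    (huT' : u (v₀ (Φ T)) < 0) (hwT : 0 < w (Φ T))
    (hin : ∀ t ∈ Ioo 0 T, 0 < u (Φ t) ∧ 0 < w (Φ t)) {η : ℝ} (hη : 0 < η) :
    ∃ ρ > 0, ∀ ε ∈ Ico 0 ρ, ∀ φ : ℝ → E,
      (∀ t ∈ Icc 0 S, HasDerivWithinAt φ (v₀ (φ t) + ε • v₁ (φ t)) (Icc 0 S) t) →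
      w (φ 0) = 0 → (∀ t ∈ Icc 0 S, dist (φ t) (Φ t) < ρ) →
      ∃ τ ∈ Ioo 0 S, |τ - T| < η ∧ u (φ τ) = 0 ∧ ∀ t ∈ Ioo 0 τ, 0 < u (φ t) ∧ 0 < w (φ t) := by
  have hΦc : ContinuousOn Φ (Icc 0 S) := fun t ht => (hΦ t ht).continuousWithinAt
  obtain ⟨r₀, hr₀, hball₀⟩ := exists_ball_forall_pos hv₀ hv₁ u w hu0 hw0
  -- At the exit the roles are exchanged: `w` is positive and `-u` increases.
  obtain ⟨r₁, hr₁, hball₁⟩ := exists_ball_forall_pos hv₀ hv₁ w (-u) hwT (by simpa using huT')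
  obtain ⟨a₀, ha₀, hnear₀⟩ := exists_forall_dist_lt_of_continuousOn hΦc
    (left_mem_Icc.2 (hT.trans hTS).le) (half_pos hr₀)
  obtain ⟨a₁, ha₁, hnear₁⟩ := exists_forall_dist_lt_of_continuousOn hΦc
    ⟨hT.le, hTS.le⟩ (half_pos hr₁)
  -- Time is cut into `[0, a]`, `[a, T - a]` and `[T - a, T + a]`; the bounds on `a` keep these
  -- ordered and inside `[0, S]`, and put the hitting time within `η` of `T`.
  obtain ⟨a, ha, haa₀, haa₁, haη, haT, haS⟩ :
      ∃ a > 0, a ≤ a₀ ∧ a ≤ a₁ ∧ a < η ∧ a < T / 2 ∧ a < S - T := by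
    have h : ∀ᶠ a in 𝓝[>] (0 : ℝ), a ≤ a₀ ∧ a ≤ a₁ ∧ a < η ∧ a < T / 2 ∧ a < S - T := by
      have key : ∀ b > (0 : ℝ), ∀ᶠ a in 𝓝[>] (0 : ℝ), a < b := fun b hb =>
        eventually_nhdsWithin_of_eventually_nhds (gt_mem_nhds hb)
      filter_upwards [key a₀ ha₀, key a₁ ha₁, key η hη, key (T / 2) (half_pos hT), key (S - T) (sub_pos.2 hTS)]
        with a h1 h2 h3 h4 h5 using ⟨h1.le, h2.le, h3, h4, h5⟩
    obtain ⟨a, h, ha⟩ := (h.and self_mem_nhdsWithin).exists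
    exact ⟨a, ha, h⟩
  have hmidc : IsCompact (Φ '' Icc a (T - a)) := isCompact_Icc.image_of_continuousOn
    (hΦc.mono (Icc_subset_Icc ha.le (by linarith)))
  obtain ⟨r₂, hr₂, hthick⟩ := hmidc.exists_thickening_subset_open
    (t := {x | 0 < u x ∧ 0 < w x})
    ((isOpen_lt continuous_const u.continuous).inter (isOpen_lt continuous_const w.continuous))
    (by rintro _ ⟨t, ht, rfl⟩; exact hin t ⟨ha.trans_le ht.1, by linarith [ht.2]⟩)
  -- The case `ε = 0` of `hball₁` gives that `u` decreases strictly along `Φ` past `T`. Being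
  -- strictly beyond the exit plane at `T + a` is then inherited by nearby orbits.
  have hend : u (Φ (T + a)) < 0 := by
    have hmono := strictMonoOn_comp_of_pos (-u) hT.le (by linarith : T + a ≤ S) hΦ
      (fun t ht => by
        have := (hball₁ 0 ⟨le_rfl, hr₁⟩ (Φ t) ((hnear₁ t ⟨by linarith [ht.1], by linarith [ht.2]⟩
          (by rw [abs_of_nonneg (by linarith [ht.1])]; linarith [ht.2])).trans
            (half_lt_self hr₁))).2
        simpa using this)
    have := hmono (left_mem_Icc.2 (by linarith)) (right_mem_Icc.2 (by linarith))
      (by linarith : T < T + a)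
    simpa [huT] using this
  obtain ⟨r₃, hr₃, hball₃⟩ := Metric.eventually_nhds_iff.1
    (u.continuous.continuousAt.eventually_lt_const hend)
  refine ⟨min (min (r₀ / 2) (r₁ / 2)) (min r₂ r₃), by positivity,
    fun ε hε φ hφ hφ0 hclose => ?_⟩
  simp only [lt_min_iff, mem_Ico] at hε hclose
  obtain ⟨hε0, ⟨hεr₀, hεr₁⟩, -⟩ := hε
  have hφc : ContinuousOn φ (Icc 0 S) := fun t ht => (hφ t ht).continuousWithinAt
  have hstart : ∀ t ∈ Icc 0 a, 0 < u (φ t) ∧ 0 < w (v₀ (φ t) + ε • v₁ (φ t)) := fun t ht => by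
    have htS : t ∈ Icc 0 S := ⟨ht.1, by linarith [ht.2]⟩
    refine hball₀ ε ⟨hε0, by linarith⟩ _ ?_
    have h1 := hnear₀ t htS (by rw [sub_zero, abs_of_nonneg ht.1]; exact ht.2.trans haa₀)
    have h2 := (hclose t htS).1.1
    linarith [dist_triangle (φ t) (Φ t) (Φ 0)]
  have hlast : ∀ t ∈ Icc (T - a) (T + a), 0 < w (φ t) ∧ 0 < (-u) (v₀ (φ t) + ε • v₁ (φ t)) :=
    fun t ht => by
      have htS : t ∈ Icc 0 S := ⟨by linarith [ht.1], by linarith [ht.2]⟩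
      refine hball₁ ε ⟨hε0, by linarith⟩ _ ?_
      have h1 := hnear₁ t htS (abs_le.2 ⟨by linarith [ht.1], by linarith [ht.2]⟩)
      have h2 := (hclose t htS).1.2
      linarith [dist_triangle (φ t) (Φ t) (Φ T)]
  have hmid : ∀ t ∈ Icc a (T - a), 0 < u (φ t) ∧ 0 < w (φ t) := fun t ht =>
    hthick (Metric.mem_thickening_iff.2 ⟨Φ t, mem_image_of_mem Φ ht,
      (hclose t ⟨ha.le.trans ht.1, by linarith [ht.2]⟩).2.1⟩)
  have hw_mono := strictMonoOn_comp_of_pos w le_rfl (by linarith : a ≤ S) hφ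
    fun t ht => (hstart t (Ioo_subset_Icc_self ht)).2
  have hu_mono := strictMonoOn_comp_of_pos (-u) (by linarith : 0 ≤ T - a)
    (by linarith : T + a ≤ S) hφ fun t ht => (hlast t (Ioo_subset_Icc_self ht)).2
  have hua : 0 < u (φ (T - a)) := (hmid _ ⟨by linarith, le_rfl⟩).1
  have hub : u (φ (T + a)) < 0 :=
    hball₃ (hclose _ ⟨by linarith, by linarith⟩).2.2
  obtain ⟨τ, hτ, huτ⟩ := intermediate_value_Icc' (by linarith : T - a ≤ T + a)
    (u.continuous.comp_continuousOn
      (hφc.mono (Icc_subset_Icc (by linarith) (by linarith)))) ⟨hub.le, hua.le⟩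
  simp only [Function.comp] at huτ
  refine ⟨τ, ⟨by linarith [hτ.1], by linarith [hτ.2]⟩,
    abs_lt.2 ⟨by linarith [hτ.1], by linarith [hτ.2]⟩, huτ, fun t ht => ?_⟩
  -- Near the start `w` increases from `0`; in the middle the thickening of the compact piece
  -- suffices; near the end `u` decreases to its zero at `τ`.
  rcases le_or_gt t a with h1 | h1
  · refine ⟨(hstart t ⟨ht.1.le, h1⟩).1, ?_⟩
    have := hw_mono (left_mem_Icc.2 ha.le) ⟨ht.1.le, h1⟩ ht.1
    simpa [hφ0] using this
  rcases le_or_gt t (T - a) with h2 | h2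
  · exact hmid t ⟨h1.le, h2⟩
  · have htm : t ∈ Icc (T - a) (T + a) := ⟨h2.le, ht.2.le.trans hτ.2⟩
    refine ⟨?_, (hlast t htm).1⟩
    have := hu_mono htm hτ ht.2
    simpa [huτ] using this

/-- Integrals along curves depend continuously on the curve and on the end point. -/
theorem exists_forall_integral_close {F : Type*} [NormedAddCommGroup F] [NormedSpace ℝ F]
    {X : Type*} [PseudoMetricSpace X] {ψ : X → F} (hψ : Continuous ψ) {S T : ℝ} (hT : T ∈ Icc 0 S) {Φ : ℝ → X}
    (hΦ : ContinuousOn Φ (Icc 0 S)) {η : ℝ} (hη : 0 < η) :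
    ∃ ρ > 0, ∀ φ : ℝ → X, ContinuousOn φ (Icc 0 S) →
      (∀ t ∈ Icc 0 S, dist (φ t) (Φ t) < ρ) → ∀ τ ∈ Icc 0 S, |τ - T| < ρ →
      ‖(∫ t in (0 : ℝ)..τ, ψ (φ t)) - ∫ t in (0 : ℝ)..T, ψ (Φ t)‖ < η := by
  have hS : 0 ≤ S := hT.1.trans hT.2
  obtain ⟨C, hC⟩ := isCompact_Icc.exists_bound_of_continuousOn (hψ.comp_continuousOn hΦ)
  have hC0 : 0 ≤ C := (norm_nonneg _).trans (hC T hT)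
  -- Uniform continuity at a compact set allows the second point to leave the set, as `φ t` may
  -- leave the trace of `Φ`. The tolerance costs at most `η / 2` over a time at most `S`; the shift
  -- of the end point costs the other half.
  obtain ⟨r, hr, hunif⟩ := Metric.mem_uniformity_dist.1
    ((isCompact_Icc.image_of_continuousOn hΦ).uniformContinuousAt_of_continuousAt ψ
      (fun x _ => hψ.continuousAt)
      (Metric.dist_mem_uniformity (by positivity : 0 < η / (2 * (S + 1)))))
  refine ⟨min r (η / (2 * (C + 1))), by positivity, fun φ hφ hclose τ hτ hτT => ?_⟩
  have hint : ∀ {f : ℝ → X}, ContinuousOn f (Icc 0 S) → ∀ {a b : ℝ}, a ∈ Icc 0 S → b ∈ Icc 0 S →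
      IntervalIntegrable (fun t => ψ (f t)) MeasureTheory.volume a b := fun hf a b ha hb =>
    ((hψ.comp_continuousOn hf).mono (ordConnected_Icc.uIcc_subset ha hb)).intervalIntegrable
  have h0 : (0 : ℝ) ∈ Icc 0 S := left_mem_Icc.2 hS
  have hsplit : (∫ t in (0 : ℝ)..τ, ψ (φ t)) - ∫ t in (0 : ℝ)..T, ψ (Φ t) =
      (∫ t in (0 : ℝ)..τ, (ψ (φ t) - ψ (Φ t))) + ∫ t in T..τ, ψ (Φ t) := by
    rw [intervalIntegral.integral_sub (hint hφ h0 hτ) (hint hΦ h0 hτ),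
      ← intervalIntegral.integral_add_adjacent_intervals (hint hΦ h0 hT) (hint hΦ hT hτ)]
    abel
  have h1 : ‖∫ t in (0 : ℝ)..τ, (ψ (φ t) - ψ (Φ t))‖ ≤ η / (2 * (S + 1)) * |τ - 0| := by
    refine intervalIntegral.norm_integral_le_of_norm_le_const fun t ht => ?_
    rw [uIoc_of_le hτ.1] at ht
    have htS : t ∈ Icc 0 S := ⟨ht.1.le, ht.2.trans hτ.2⟩
    have := hunif (a := Φ t) (b := φ t)
      (by rw [dist_comm]; exact (hclose t htS).trans_le (min_le_left _ _)) (mem_image_of_mem Φ htS)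
    rw [← dist_eq_norm, dist_comm]
    exact le_of_lt this
  have h2 : ‖∫ t in T..τ, ψ (Φ t)‖ ≤ C * |τ - T| :=
    intervalIntegral.norm_integral_le_of_norm_le_const fun t ht =>
      hC t (ordConnected_Icc.uIcc_subset hT hτ (uIoc_subset_uIcc ht))
  have h3 : η / (2 * (S + 1)) * |τ - 0| ≤ η / 2 := by
    rw [sub_zero, abs_of_nonneg hτ.1, div_mul_eq_mul_div, div_le_div_iff₀ (by positivity) two_pos]
    nlinarith [hτ.2]
  have h4 : C * |τ - T| < η / 2 := by
    have h5 := hτT.trans_le (min_le_right _ _)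
    rw [lt_div_iff₀ (by positivity)] at h5
    nlinarith [abs_nonneg (τ - T), mul_nonneg hC0 (abs_nonneg (τ - T))]
  rw [hsplit]
  linarith [norm_add_le (∫ t in (0 : ℝ)..τ, (ψ (φ t) - ψ (Φ t))) (∫ t in T..τ, ψ (Φ t))]

/-- Transversal passage between hyperplanes, together with convergence of the end points and of
integrals along the orbits, for small perturbations of the field and of the initial point. -/
theorem exists_hit_of_perturbation [FiniteDimensional ℝ E] {F : Type*} [NormedAddCommGroup F]
    [NormedSpace ℝ F] {v₀ v₁ : E → E}
    (hv₀ : ContDiff ℝ 1 v₀) (hv₁ : ContDiff ℝ 1 v₁) {ψ : E → F} (hψ : Continuous ψ)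
    (u w : E →L[ℝ] ℝ) {T : ℝ} (hT : 0 < T) {φ₀ : ℝ → E}
    (hφ₀ : ∀ t ∈ Icc 0 T, HasDerivWithinAt φ₀ (v₀ (φ₀ t)) (Icc 0 T) t)
    (hu0 : 0 < u (φ₀ 0)) (hw0 : 0 < w (v₀ (φ₀ 0))) (huT : u (φ₀ T) = 0)
    (huT' : u (v₀ (φ₀ T)) < 0) (hwT : 0 < w (φ₀ T))
    (hin : ∀ t ∈ Ioo 0 T, 0 < u (φ₀ t) ∧ 0 < w (φ₀ t)) {η : ℝ} (hη : 0 < η) :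
    ∃ ρ > 0, ∀ ε ∈ Ico 0 ρ, ∀ p, dist p (φ₀ 0) < ρ → w p = 0 →
      ∃ τ > 0, ∃ φ : ℝ → E, φ 0 = p ∧
        (∀ t ∈ Icc 0 τ, HasDerivWithinAt φ (v₀ (φ t) + ε • v₁ (φ t)) (Icc 0 τ) t) ∧
        (∀ t ∈ Ioo 0 τ, 0 < u (φ t) ∧ 0 < w (φ t)) ∧ u (φ τ) = 0 ∧
        dist (φ τ) (φ₀ T) < η ∧
        ‖(∫ t in (0 : ℝ)..τ, ψ (φ t)) - ∫ t in (0 : ℝ)..T, ψ (φ₀ t)‖ < η := by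
  obtain ⟨S, hTS, Φ, heq, hΦ, hpert⟩ := exists_extension_forall_perturbation hv₀ hv₁ hT hφ₀
  have hΦc : ContinuousOn Φ (Icc 0 S) := fun t ht => (hΦ t ht).continuousWithinAt
  have hTmem : T ∈ Icc 0 S := ⟨hT.le, hTS.le⟩
  have heq0 : Φ 0 = φ₀ 0 := heq (left_mem_Icc.2 hT.le)
  have heqT : Φ T = φ₀ T := heq (right_mem_Icc.2 hT.le)
  obtain ⟨ρ₁, hρ₁, hintegral⟩ := exists_forall_integral_close hψ hTmem hΦc hη
  obtain ⟨a, ha, hnear⟩ := exists_forall_dist_lt_of_continuousOn hΦc hTmem (half_pos hη)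
  obtain ⟨ρ₂, hρ₂, hhit⟩ := exists_hit_of_close hv₀.continuous hv₁.continuous u w hT hTS hΦ
    (by rwa [heq0]) (by rwa [heq0]) (by rwa [heqT]) (by rwa [heqT]) (by rwa [heqT])
    (fun t ht => by rw [heq (Ioo_subset_Icc_self ht)]; exact hin t ht) (lt_min hρ₁ ha)
  obtain ⟨ρ₃, hρ₃, hsol⟩ := hpert (min (min ρ₁ ρ₂) (η / 2)) (by positivity)
  refine ⟨min ρ₂ ρ₃, lt_min hρ₂ hρ₃, fun ε hε p hp hwp => ?_⟩
  obtain ⟨φ, hφ0, hφ, hclose⟩ := hsol ε ⟨hε.1, hε.2.trans_le (min_le_right _ _)⟩ p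
    (hp.trans_le (min_le_right _ _))
  simp only [lt_min_iff] at hclose
  obtain ⟨τ, hτ, hτT, huτ, hpos⟩ := hhit ε ⟨hε.1, hε.2.trans_le (min_le_left _ _)⟩ φ hφ
    (by rwa [hφ0]) (fun t ht => (hclose t ht).1.2)
  rw [lt_min_iff] at hτT
  have hτm : τ ∈ Icc 0 S := Ioo_subset_Icc_self hτ
  have hsub : Icc 0 τ ⊆ Icc 0 S := Icc_subset_Icc_right hτ.2.le
  refine ⟨τ, hτ.1, φ, hφ0, fun t ht => (hφ t (hsub ht)).mono hsub, hpos, huτ, ?_, ?_⟩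
  · have h1 := (hclose τ hτm).2
    have h2 := hnear τ hτm hτT.2.le
    rw [heqT] at h2
    linarith [dist_triangle (φ τ) (Φ τ) (φ₀ T)]
  · have h := hintegral φ (fun t ht => (hφ t ht).continuousWithinAt)
      (fun t ht => (hclose t ht).1.1) τ hτm hτT.1
    rwa [intervalIntegral.integral_congr (a := 0) (b := T) (g := fun t => ψ (φ₀ t))
      (fun t ht => by
        rw [uIcc_of_le hT.le] at ht
        simp only [heq ht])] at h

end Hitting

variable {d : ℕ}

/-! ### Quadrants and switching planes through linear functionals. -/

section Quadrants

/-- The linear functional that is positive in the `k`-th quadrant and vanishes on the plane through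
which clockwise orbits leave it. -/
noncomputable def exitFunctional : Fin 4 → Phase d →L[ℝ] ℝ :=
  let x₁ := ContinuousLinearMap.fst ℝ ℝ (ℝ × (Fin d → ℝ))
  let x₂ := (ContinuousLinearMap.fst ℝ ℝ (Fin d → ℝ)).comp
    (ContinuousLinearMap.snd ℝ ℝ (ℝ × (Fin d → ℝ)))
  ![x₂, x₁, -x₂, -x₁]

/-- The linear functional that is positive in the `k`-th quadrant and vanishes on the plane through
which clockwise orbits enter it. -/
noncomputable def entryFunctional (k : Fin 4) : Phase d →L[ℝ] ℝ := -exitFunctional (k - 1)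

theorem entryFunctional_succ (k : Fin 4) :
    (entryFunctional (k + 1) : Phase d →L[ℝ] ℝ) = -exitFunctional k := by
  simp [entryFunctional]

theorem mem_openQuadrant_iff (k : Fin 4) (x : Phase d) :
    (x.1, x.2.1) ∈ openQuadrant k ↔ 0 < exitFunctional k x ∧ 0 < entryFunctional k x := by
  fin_cases k <;> simp [openQuadrant, exitFunctional, entryFunctional, and_comm]

theorem mem_exitPlane_iff (k : Fin 4) (x : Phase d) :
    x ∈ exitPlane k ↔ exitFunctional k x = 0 := by
  fin_cases k <;> simp [exitPlane, exitFunctional]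

end Quadrants

/-! ### Variation of the first integrals along perturbed orbits. -/

section Derivatives

variable {H : Phase d → ℝ}

theorem dx1_eq_fderiv (hH : Differentiable ℝ H) (x : Phase d) :
    dx1 H x = fderiv ℝ H x (1, 0, 0) := by
  have hc : HasDerivAt (fun s : ℝ => ((s, x.2.1, x.2.2) : Phase d)) (1, 0, 0) x.1 :=
    (hasDerivAt_id x.1).prodMk (hasDerivAt_const x.1 x.2)
  exact ((hH x).hasFDerivAt.comp_hasDerivAt x.1 hc).deriv

theorem dx2_eq_fderiv (hH : Differentiable ℝ H) (x : Phase d) :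
    dx2 H x = fderiv ℝ H x (0, 1, 0) := by
  have hc : HasDerivAt (fun s : ℝ => ((x.1, s, x.2.2) : Phase d)) (0, 1, 0) x.2.1 :=
    (hasDerivAt_const x.2.1 x.1).prodMk
      ((hasDerivAt_id x.2.1).prodMk (hasDerivAt_const x.2.1 x.2.2))
  exact ((hH x).hasFDerivAt.comp_hasDerivAt x.2.1 hc).deriv

theorem dy_eq_fderiv (hH : Differentiable ℝ H) (i : Fin d) (x : Phase d) :
    dy H i x = fderiv ℝ H x (0, 0, Pi.single i 1) := by
  have hc : HasDerivAt (fun s : ℝ => ((x.1, x.2.1, Function.update x.2.2 i s) : Phase d))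
      (0, 0, Pi.single i 1) (x.2.2 i) :=
    (hasDerivAt_const _ x.1).prodMk
      ((hasDerivAt_const _ x.2.1).prodMk (hasDerivAt_update x.2.2 i (x.2.2 i)))
  have hx : HasFDerivAt H (fderiv ℝ H x) (x.1, x.2.1, Function.update x.2.2 i (x.2.2 i)) := by
    rw [Function.update_eq_self]
    exact (hH x).hasFDerivAt
  exact (hx.comp_hasDerivAt (x.2.2 i) hc).deriv

theorem fderiv_apply_eq (hH : Differentiable ℝ H) (x z : Phase d) :
    fderiv ℝ H x z = dx1 H x * z.1 + dx2 H x * z.2.1 + ∑ i, dy H i x * z.2.2 i := by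
  have hz : z = z.1 • ((1, 0, 0) : Phase d) + z.2.1 • ((0, 1, 0) : Phase d) +
      ∑ i, z.2.2 i • ((0, 0, Pi.single i 1) : Phase d) := by
    have hsum : ∑ i, z.2.2 i • ((0, 0, Pi.single i 1) : Phase d) = (0, 0, z.2.2) := by
      refine Prod.ext ?_ (Prod.ext ?_ ?_)
      · simp [Prod.fst_sum]
      · simp [Prod.snd_sum, Prod.fst_sum]
      · ext j
        simp [Prod.snd_sum, Finset.sum_apply, Pi.single_apply]
    rw [hsum]
    simp
  conv_lhs => rw [hz]
  simp only [map_add, map_sum, map_smul, ← dx1_eq_fderiv hH, ← dx2_eq_fderiv hH,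
    ← dy_eq_fderiv hH, smul_eq_mul, mul_comm]

theorem contDiff_hamiltonianField (hH : ContDiff ℝ ∞ H) :
    ContDiff ℝ 1 fun x : Phase d => ((dx2 H x, -dx1 H x, 0) : Phase d) := by
  have hd : Differentiable ℝ H := hH.differentiable (by simp)
  have hf : ContDiff ℝ 1 (fderiv ℝ H) := hH.fderiv_right (by norm_cast)
  simp only [dx1_eq_fderiv hd, dx2_eq_fderiv hd]
  exact (hf.clm_apply contDiff_const).prodMk
    ((hf.clm_apply contDiff_const).neg.prodMk contDiff_const)

/-- The derivative of `(H, x₃, …, xₙ)` along the field `g`. -/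
noncomputable def fluxDensity (H : Phase d → ℝ) (g : Phase d → Phase d) (x : Phase d) : ℝ × (Fin d → ℝ) :=
  (fderiv ℝ H x (g x), (g x).2.2)

theorem continuous_fluxDensity (hH : ContDiff ℝ ∞ H) {g : Phase d → Phase d}
    (hg : Continuous g) : Continuous (fluxDensity H g) := by
  have hf : Continuous (fderiv ℝ H) := hH.continuous_fderiv (by simp)
  exact (hf.clm_apply hg).prodMk hg.snd.snd

/-- The first integrals change along a perturbed orbit by `ε` times an integral of `g`. -/
theorem firstIntegrals_sub_eq (hH : ContDiff ℝ ∞ H) {g : Phase d → Phase d}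
    (hg : Continuous g) {ε τ : ℝ} (hτ : 0 ≤ τ) {φ : ℝ → Phase d}
    (hφ : ∀ t ∈ Icc 0 τ, HasDerivWithinAt φ (vectorField H g ε (φ t)) (Icc 0 τ) t) :
    firstIntegrals H (φ τ) - firstIntegrals H (φ 0) =
      ε • ∫ t in (0 : ℝ)..τ, fluxDensity H g (φ t) := by
  have hd : Differentiable ℝ H := hH.differentiable (by simp)
  have hφc : ContinuousOn φ (Icc 0 τ) := fun t ht => (hφ t ht).continuousWithinAt
  have hI : Continuous (firstIntegrals H) := hH.continuous.prodMk continuous_snd.snd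
  rw [← intervalIntegral.integral_smul]
  symm
  refine intervalIntegral.integral_eq_sub_of_hasDeriv_right
    (f := fun t => firstIntegrals H (φ t)) ?_ ?_ ?_
  · rw [uIcc_of_le hτ]
    exact hI.comp_continuousOn hφc
  · intro t ht
    rw [min_eq_left hτ, max_eq_right hτ] at ht
    have hφt := (hφ t (Ioo_subset_Icc_self ht)).hasDerivAt (Icc_mem_nhds ht.1 ht.2)
    have hy : HasDerivAt (fun t => (φ t).2.2) (vectorField H g ε (φ t)).2.2 t := hφt.snd.snd
    have h := ((hd (φ t)).hasFDerivAt.comp_hasDerivAt t hφt).prodMk hy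
    refine HasDerivAt.hasDerivWithinAt (h.congr_deriv ?_)
    refine Prod.ext ?_ ?_
    -- The Hamiltonian part contributes `H_{x₁} H_{x₂} - H_{x₂} H_{x₁} = 0`; only `ε` times the
    -- derivative along `g` survives.
    · simp only [fluxDensity, Prod.smul_fst, fderiv_apply_eq hd]
      simp [vectorField, mul_add, Finset.mul_sum, mul_left_comm, mul_comm]
      ring
    · simp [fluxDensity, vectorField]
  · refine ContinuousOn.intervalIntegrable ?_
    rw [uIcc_of_le hτ]
    exact ((continuous_fluxDensity hH hg).comp_continuousOn hφc).const_smul ε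

end Derivatives

/-! ### Passage through one quadrant: uniqueness, Melnikov integrals, persistence. -/

theorem isFirstHit_unique {H : Phase d → ℝ} (hH : ContDiff ℝ ∞ H)
    {g : Fin 4 → Phase d → Phase d} {k : Fin 4} (hg : ContDiff ℝ 1 (g k)) {ε : ℝ}
    {p q q' : Phase d} (hq : IsFirstHit H g ε k p q) (hq' : IsFirstHit H g ε k p q') :
    q = q' := by
  wlog hle : hq.choose ≤ hq'.choose generalizing q q'
  · exact (this hq' hq (le_of_not_ge hle)).symm
  obtain ⟨φ, hT, hφ0, hφT, hφ, -, hqmem⟩ := hq.choose_spec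
  obtain ⟨φ', hT', hφ0', hφT', hφ', hin', -⟩ := hq'.choose_spec
  set T := hq.choose
  set T' := hq'.choose
  have hv : ContDiff ℝ 1 (vectorField H (g k) ε) :=
    (contDiff_hamiltonianField hH).add (hg.const_smul ε)
  have hsub : Icc 0 T ⊆ Icc 0 T' := Icc_subset_Icc_right hle
  have hφc : ContinuousOn φ (Icc 0 T) := fun t ht => (hφ t ht).continuousWithinAt
  have hφc' : ContinuousOn φ' (Icc 0 T) := fun t ht =>
    ((hφ' t (hsub ht)).mono hsub).continuousWithinAt
  -- The field is only locally Lipschitz; one constant is available on the compact union of the two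
  -- traces.
  obtain ⟨K, hK⟩ := LocallyLipschitzOn.exists_lipschitzOnWith_of_compact
    ((isCompact_Icc.image_of_continuousOn hφc).union (isCompact_Icc.image_of_continuousOn hφc'))
    (hv.locallyLipschitz.locallyLipschitzOn)
  have heq : EqOn φ φ' (Icc 0 T) :=
    ODE_solution_unique_of_mem_Icc_right (v := fun _ => vectorField H (g k) ε)
      (fun _ _ => hK) hφc
      (fun t ht => hasDerivWithinAt_Ici_of_Icc ht (hφ t (Ico_subset_Icc_self ht)))
      (fun t ht => Or.inl (mem_image_of_mem φ (Ico_subset_Icc_self ht))) hφc'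
      (fun t ht => hasDerivWithinAt_Ici_of_Icc ⟨ht.1, ht.2.trans_le hle⟩
        (hφ' t (hsub (Ico_subset_Icc_self ht))))
      (fun t ht => Or.inr (mem_image_of_mem φ' (Ico_subset_Icc_self ht)))
      (hφ0.trans hφ0'.symm)
  have hqφ' : φ' T = q := by rw [← heq (right_mem_Icc.2 hT.le), hφT]
  rcases hle.eq_or_lt with h | h
  · rw [← hqφ', ← hφT', h]
  -- If the second orbit went on past `T`, it would lie at time `T` both in the open quadrant and on
  -- the exit plane.
  · have hpos := ((mem_openQuadrant_iff k _).1 (hin' T ⟨hT, h⟩)).1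
    rw [hqφ', (mem_exitPlane_iff k q).1 hqmem] at hpos
    exact absurd hpos (lt_irrefl 0)

/-- The Melnikov integrals of one arc as a single vector-valued integral. -/
theorem integral_fluxDensity_eq {H : Phase d → ℝ} (hH : ContDiff ℝ ∞ H) {g : Phase d → Phase d}
    (hg : Continuous g) {hhat : Fin d → ℝ} {T : ℝ} (hT : 0 < T) {γ : ℝ → ℝ × ℝ}
    (hγ : ∀ t ∈ Icc 0 T, HasDerivWithinAt γ
      (dx2 H ((γ t).1, (γ t).2, hhat), -dx1 H ((γ t).1, (γ t).2, hhat)) (Icc 0 T) t) :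
    ∫ t in (0 : ℝ)..T, fluxDensity H g ((γ t).1, (γ t).2, hhat) =
      (M1 g hhat T γ + N H g hhat T γ, fun i => Mj g hhat i T γ) := by
  have hd : Differentiable ℝ H := hH.differentiable (by simp)
  have hγc : ContinuousOn (fun t => (((γ t).1, (γ t).2, hhat) : Phase d)) (uIcc 0 T) := by
    rw [uIcc_of_le hT.le]
    have h : ContinuousOn γ (Icc 0 T) := fun t ht => (hγ t ht).continuousWithinAt
    exact h.fst.prodMk (h.snd.prodMk continuousOn_const)
  have hdx1 : Continuous (dx1 H) := by
    rw [funext (dx1_eq_fderiv hd)]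
    exact (hH.continuous_fderiv (by simp)).clm_apply continuous_const
  have hdx2 : Continuous (dx2 H) := by
    rw [funext (dx2_eq_fderiv hd)]
    exact (hH.continuous_fderiv (by simp)).clm_apply continuous_const
  have hdy : ∀ i, Continuous (dy H i) := fun i => by
    rw [funext (dy_eq_fderiv hd i)]
    exact (hH.continuous_fderiv (by simp)).clm_apply continuous_const
  have hint : ∀ {F : Type} [NormedAddCommGroup F] {f : Phase d → F}, Continuous f →
      IntervalIntegrable (fun t => f ((γ t).1, (γ t).2, hhat)) MeasureTheory.volume 0 T :=
    fun hf => (hf.comp_continuousOn hγc).intervalIntegrable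
  have hflux := hint (continuous_fluxDensity hH hg)
  refine Prod.ext ?_ (funext fun i => ?_)
  · have h := (ContinuousLinearMap.fst ℝ ℝ (Fin d → ℝ)).intervalIntegral_comp_comm hflux
    simp only [ContinuousLinearMap.coe_fst'] at h
    rw [← h]
    have hplane : Continuous fun x => (g x).2.1 * dx2 H x + (g x).1 * dx1 H x := by fun_prop
    have hslow : ∀ i, Continuous fun x => dy H i x * (g x).2.2 i := fun i => by
      have := hdy i
      fun_prop
    have hslow_sum : Continuous fun x => ∑ i, dy H i x * (g x).2.2 i :=
      continuous_finsetSum _ fun i _ => hslow i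
    have hM1 : M1 g hhat T γ = ∫ t in (0 : ℝ)..T,
        ((fun x => (g x).2.1 * dx2 H x + (g x).1 * dx1 H x) ((γ t).1, (γ t).2, hhat) : ℝ) := by
      rw [M1, lineIntegral]
      refine intervalIntegral.integral_congr_ae ?_
      -- At `T` the curve has only a one-sided derivative, so `deriv` may take its default value
      -- there; a single point does not affect the integral.
      have hne : ∀ᵐ t : ℝ, t ≠ T := by simp [MeasureTheory.ae_iff]
      filter_upwards [hne] with t htT ht
      rw [uIoc_of_le hT.le] at ht
      have hγt := (hγ t (Ioc_subset_Icc_self ht)).hasDerivAt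
        (Icc_mem_nhds ht.1 (lt_of_le_of_ne ht.2 htT))
      have h1 : HasDerivAt (fun s => (γ s).1) (dx2 H ((γ t).1, (γ t).2, hhat)) t := hγt.fst
      have h2 : HasDerivAt (fun s => (γ s).2) (-dx1 H ((γ t).1, (γ t).2, hhat)) t := hγt.snd
      rw [h1.deriv, h2.deriv]
      ring
    have hN : N H g hhat T γ = ∫ t in (0 : ℝ)..T,
        (fun x => ∑ i, dy H i x * (g x).2.2 i) ((γ t).1, (γ t).2, hhat) :=
      (intervalIntegral.integral_finsetSum fun i _ => hint (hslow i)).symm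
    rw [hM1, hN, ← intervalIntegral.integral_add (hint hplane) (hint hslow_sum)]
    refine intervalIntegral.integral_congr fun t _ => ?_
    simp only [fluxDensity, fderiv_apply_eq hd]
    ring
  · have h := ((ContinuousLinearMap.proj (R := ℝ) (φ := fun _ : Fin d => ℝ) i).comp
      (ContinuousLinearMap.snd ℝ ℝ (Fin d → ℝ))).intervalIntegral_comp_comm hflux
    exact h.symm

/-- The end point is a minimum, and the interval offers only inward directions there. This and its
mirror image below give the weak signs of the crossing velocities; (H2) makes them strict, so the
clockwise direction of crossing comes from the arc itself. -/
theorem deriv_nonneg_of_nonneg_of_eq_zero_left {f : ℝ → ℝ} {f' T : ℝ} (hT : 0 < T)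
    (hf : HasDerivWithinAt f f' (Icc 0 T) 0) (h0 : f 0 = 0) (hpos : ∀ t ∈ Icc 0 T, 0 ≤ f t) :
    0 ≤ f' := by
  have hmin : IsLocalMinOn f (Icc 0 T) 0 :=
    eventually_nhdsWithin_of_forall fun t ht => by rw [h0]; exact hpos t ht
  have h := hmin.hasFDerivWithinAt_nonneg hf.hasFDerivWithinAt
    (sub_mem_posTangentConeAt_of_segment_subset (y := T) (segment_eq_Icc hT.le).subset)
  simpa [hT] using h

theorem deriv_nonpos_of_nonneg_of_eq_zero_right {f : ℝ → ℝ} {f' T : ℝ} (hT : 0 < T)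
    (hf : HasDerivWithinAt f f' (Icc 0 T) T) (hfT : f T = 0) (hpos : ∀ t ∈ Icc 0 T, 0 ≤ f t) :
    f' ≤ 0 := by
  have hmin : IsLocalMinOn f (Icc 0 T) T :=
    eventually_nhdsWithin_of_forall fun t ht => by rw [hfT]; exact hpos t ht
  have h := hmin.hasFDerivWithinAt_nonneg hf.hasFDerivWithinAt
    (sub_mem_posTangentConeAt_of_segment_subset (y := 0)
      (by rw [segment_symm]; exact (segment_eq_Icc hT.le).subset))
  simp only [zero_sub, ContinuousLinearMap.map_neg, ContinuousLinearMap.toSpanSingleton_apply,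
    smul_eq_mul] at h
  nlinarith

/-- The perturbed orbits from points of the entry plane near the start of an arc cross the quadrant
to a point near the end of the arc, and the first integrals change by `ε` times a vector near the
Melnikov integrals of the arc. -/
theorem IsOrbitalArc.exists_isFirstHit_near {H : Phase d → ℝ} (hH : ContDiff ℝ ∞ H)
    {g : Fin 4 → Phase d → Phase d} {k : Fin 4} (hg : ContDiff ℝ 1 (g k)) {h₁ : ℝ}
    {hhat : Fin d → ℝ} {p q : ℝ × ℝ} {T : ℝ} {γ : ℝ → ℝ × ℝ}
    (harc : IsOrbitalArc H h₁ hhat k p q T γ)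
    (hp : 0 < exitFunctional k (p.1, p.2, hhat)) (hp' : entryFunctional k (p.1, p.2, hhat) = 0)
    (hpt : entryFunctional k (vectorField H (g k) 0 (p.1, p.2, hhat)) ≠ 0)
    (hq : exitFunctional k (q.1, q.2, hhat) = 0) (hq' : 0 < entryFunctional k (q.1, q.2, hhat))
    (hqt : exitFunctional k (vectorField H (g k) 0 (q.1, q.2, hhat)) ≠ 0)
    {η : ℝ} (hη : 0 < η) :
    ∃ ρ > 0, ∀ ε ∈ Ico 0 ρ, ∀ x : Phase d, dist x (p.1, p.2, hhat) < ρ →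
      entryFunctional k x = 0 → ∃ y, IsFirstHit H g ε k x y ∧ dist y (q.1, q.2, hhat) < η ∧
        ∃ I, firstIntegrals H y - firstIntegrals H x = ε • I ∧
          dist I (M1 (g k) hhat T γ + N H (g k) hhat T γ, fun i => Mj (g k) hhat i T γ) < η := by
  obtain ⟨hT, hγ0, hγT, hγ, hin, -⟩ := harc
  set φ₀ : ℝ → Phase d := fun t => ((γ t).1, (γ t).2, hhat) with hφ₀def
  have h0 : φ₀ 0 = (p.1, p.2, hhat) := by simp only [hφ₀def, hγ0]
  have h1 : φ₀ T = (q.1, q.2, hhat) := by simp only [hφ₀def, hγT]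
  have hφ₀ : ∀ t ∈ Icc 0 T, HasDerivWithinAt φ₀
      (dx2 H (φ₀ t), -dx1 H (φ₀ t), 0) (Icc 0 T) t := fun t ht => by
    have hx₁ : HasDerivWithinAt (fun s => (γ s).1) (dx2 H (φ₀ t)) (Icc 0 T) t := (hγ t ht).fst
    have hx₂ : HasDerivWithinAt (fun s => (γ s).2) (-dx1 H (φ₀ t)) (Icc 0 T) t := (hγ t ht).snd
    exact hx₁.prodMk (hx₂.prodMk (hasDerivWithinAt_const t _ hhat))
  have hpos : ∀ t ∈ Ioo 0 T, 0 < exitFunctional k (φ₀ t) ∧ 0 < entryFunctional k (φ₀ t) :=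
    fun t ht => (mem_openQuadrant_iff k (φ₀ t)).1 (hin t ht)
  have hnonneg : ∀ t ∈ Icc 0 T, 0 ≤ exitFunctional k (φ₀ t) ∧ 0 ≤ entryFunctional k (φ₀ t) :=
    fun t ht => by
      rcases ht.1.eq_or_lt with rfl | h0t
      · rw [h0]; exact ⟨hp.le, hp'.ge⟩
      rcases ht.2.eq_or_lt with rfl | htT
      · rw [h1]; exact ⟨hq.ge, hq'.le⟩
      · exact ⟨(hpos t ⟨h0t, htT⟩).1.le, (hpos t ⟨h0t, htT⟩).2.le⟩
  simp only [vectorField, zero_smul, add_zero, ← h0, ← h1] at hp hp' hpt hq hq' hqt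
  have hpt' := (deriv_nonneg_of_nonneg_of_eq_zero_left hT
    ((entryFunctional k).hasFDerivAt.comp_hasDerivWithinAt 0 (hφ₀ 0 (left_mem_Icc.2 hT.le)))
    hp' fun t ht => (hnonneg t ht).2).lt_of_ne' hpt
  have hqt' := (deriv_nonpos_of_nonneg_of_eq_zero_right hT
    ((exitFunctional k).hasFDerivAt.comp_hasDerivWithinAt T (hφ₀ T (right_mem_Icc.2 hT.le)))
    hq fun t ht => (hnonneg t ht).1).lt_of_ne hqt
  obtain ⟨ρ, hρ, hhit⟩ := exists_hit_of_perturbation (contDiff_hamiltonianField hH) hg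
    (continuous_fluxDensity hH hg.continuous) (exitFunctional k) (entryFunctional k) hT hφ₀
    hp hpt' hq hqt' hq' hpos hη
  rw [← h0, ← h1]
  refine ⟨ρ, hρ, fun ε hε x hx hxe => ?_⟩
  obtain ⟨τ, hτ, φ, hφ0, hφ, hφpos, hφτ, hdist, hnorm⟩ := hhit ε hε x hx hxe
  refine ⟨φ τ, ⟨τ, φ, hτ, hφ0, rfl, hφ, fun t ht => (mem_openQuadrant_iff k _).2 (hφpos t ht),
    (mem_exitPlane_iff k _).2 hφτ⟩, hdist,
    ∫ t in (0 : ℝ)..τ, fluxDensity H (g k) (φ t), ?_, ?_⟩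
  · rw [← hφ0]
    exact firstIntegrals_sub_eq hH hg.continuous hτ.le hφ
  · rw [← integral_fluxDensity_eq hH hg.continuous hT hγ, dist_eq_norm]
    exact hnorm

/-! ### Composition of the four passages and the limit of the difference quotient. -/

theorem isPoincareImage_unique {H : Phase d → ℝ} (hH : ContDiff ℝ ∞ H)
    {g : Fin 4 → Phase d → Phase d} (hg : ∀ k, ContDiff ℝ 1 (g k)) {ε : ℝ} {a a' a'' : Phase d}
    (h : IsPoincareImage H g ε a a') (h' : IsPoincareImage H g ε a a'') : a' = a'' := by
  obtain ⟨b, c, e, hb, hc, he, ha⟩ := h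
  obtain ⟨b', c', e', hb', hc', he', ha'⟩ := h'
  obtain rfl := isFirstHit_unique hH (hg 0) hb hb'
  obtain rfl := isFirstHit_unique hH (hg 1) hc hc'
  obtain rfl := isFirstHit_unique hH (hg 2) he he'
  exact isFirstHit_unique hH (hg 3) ha ha'

/-- This lets passages be chained: the end point of one is an admissible start of the next. -/
theorem IsFirstHit.entryFunctional_succ_eq_zero {H : Phase d → ℝ} {g : Fin 4 → Phase d → Phase d}
    {ε : ℝ} {k : Fin 4} {p q : Phase d} (h : IsFirstHit H g ε k p q) :
    entryFunctional (k + 1) q = 0 := by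
  obtain ⟨_, _, _, _, _, _, _, hq⟩ := h
  simp [entryFunctional_succ, (mem_exitPlane_iff k q).1 hq]

/-- Four consecutive passages that depend continuously on `ε` and on the starting point compose to
the Poincaré map. -/
theorem exists_isPoincareImage_near {H : Phase d → ℝ} {g : Fin 4 → Phase d → Phase d}
    {P : Fin 4 → Phase d} {M : Fin 4 → ℝ × (Fin d → ℝ)} (hP : entryFunctional 0 (P 0) = 0)
    (harc : ∀ k, ∀ η > 0, ∃ ρ > 0, ∀ ε ∈ Ico 0 ρ, ∀ x, dist x (P k) < ρ →
      entryFunctional k x = 0 → ∃ y, IsFirstHit H g ε k x y ∧ dist y (P (k + 1)) < η ∧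
        ∃ I, firstIntegrals H y - firstIntegrals H x = ε • I ∧ dist I (M k) < η)
    {η : ℝ} (hη : 0 < η) :
    ∃ ρ > 0, ∀ ε ∈ Ico 0 ρ, ∃ a, IsPoincareImage H g ε (P 0) a ∧
      ∃ I, firstIntegrals H a - firstIntegrals H (P 0) = ε • I ∧ dist I (∑ k, M k) < η := by
  -- Tolerances are chosen backwards, since each passage must land in the neighbourhood where the
  -- next one applies; each contributes at most `η / 4` to the error.
  obtain ⟨ρ₃, hρ₃, h₃⟩ := harc 3 (η / 4) (by positivity)
  obtain ⟨ρ₂, hρ₂, h₂⟩ := harc 2 (min ρ₃ (η / 4)) (by positivity)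
  obtain ⟨ρ₁, hρ₁, h₁⟩ := harc 1 (min ρ₂ (η / 4)) (by positivity)
  obtain ⟨ρ₀, hρ₀, h₀⟩ := harc 0 (min ρ₁ (η / 4)) (by positivity)
  refine ⟨min (min ρ₀ ρ₁) (min ρ₂ ρ₃), by positivity, fun ε hε => ?_⟩
  simp only [mem_Ico, lt_min_iff] at hε h₀ h₁ h₂
  obtain ⟨hε0, ⟨hε₀, hε₁⟩, hε₂, hε₃⟩ := hε
  obtain ⟨b, hb, hbd, I₀, hI₀, hI₀d⟩ := h₀ ε ⟨hε0, hε₀⟩ (P 0) (by simpa using hρ₀) hP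
  obtain ⟨c, hc, hcd, I₁, hI₁, hI₁d⟩ := h₁ ε ⟨hε0, hε₁⟩ b hbd.1 hb.entryFunctional_succ_eq_zero
  obtain ⟨e, he, hed, I₂, hI₂, hI₂d⟩ := h₂ ε ⟨hε0, hε₂⟩ c hcd.1 hc.entryFunctional_succ_eq_zero
  obtain ⟨a, ha, -, I₃, hI₃, hI₃d⟩ := h₃ ε ⟨hε0, hε₃⟩ e hed.1 he.entryFunctional_succ_eq_zero
  refine ⟨a, ⟨b, c, e, hb, hc, he, ha⟩, I₀ + I₁ + I₂ + I₃, ?_, ?_⟩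
  · rw [smul_add, smul_add, smul_add, ← hI₀, ← hI₁, ← hI₂, ← hI₃]
    abel
  · rw [Fin.sum_univ_four]
    have h := (dist_add_add_le (I₀ + I₁ + I₂) I₃ (M 0 + M 1 + M 2) (M 3)).trans
      (add_le_add_left ((dist_add_add_le (I₀ + I₁) I₂ (M 0 + M 1) (M 2)).trans
        (add_le_add_left (dist_add_add_le I₀ I₁ (M 0) (M 1)) _)) _)
    linarith [hI₀d.2, hI₁d.2, hI₂d.2]

/-- Existence of the Poincaré images with convergent difference quotients of the first integrals,
and uniqueness, give the Melnikov vector. -/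
theorem isMelnikovVector_of_forall_near {H : Phase d → ℝ} {g : Fin 4 → Phase d → Phase d}
    {a : Phase d} {M : ℝ × (Fin d → ℝ)}
    (hunique : ∀ ε a' a'', IsPoincareImage H g ε a a' → IsPoincareImage H g ε a a'' → a' = a'')
    (hnear : ∀ η > 0, ∃ ρ > 0, ∀ ε ∈ Ico 0 ρ, ∃ a', IsPoincareImage H g ε a a' ∧
      ∃ I, firstIntegrals H a' - firstIntegrals H a = ε • I ∧ dist I M < η) :
    IsMelnikovVector H g a M := by
  classical
  -- The tolerance `1` is arbitrary; it only fixes a range of `ε` on which images exist.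
  obtain ⟨ε₀, hε₀, hex⟩ := hnear 1 one_pos
  choose! A hA hI using hex
  refine ⟨ε₀, hε₀, A,
    -- The value at `0` is prescribed to be `M`, so all the content lies in continuity at `0`.
    fun ε => if ε = 0 then M else ε⁻¹ • (firstIntegrals H (A ε) - firstIntegrals H a),
    fun ε hε a' => ⟨fun h => hunique ε _ _ h (hA ε hε), fun h => h ▸ hA ε hε⟩, fun ε hε => ?_, ?_,
    by simp⟩
  · by_cases h : ε = 0
    · subst h
      obtain ⟨I, hI, -⟩ := hI 0 hε
      simp [hI]
    · simp [h]
  · rw [Metric.continuousWithinAt_iff]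
    intro η hη
    obtain ⟨ρ, hρ, hρM⟩ := hnear η hη
    refine ⟨min ρ ε₀, lt_min hρ hε₀, fun {ε} hε hεd => ?_⟩
    have hε' : ε < min ρ ε₀ := by simpa [abs_of_nonneg (mem_Ici.1 hε)] using hεd
    rw [lt_min_iff] at hε'
    by_cases h : ε = 0
    · simpa [h] using hη
    · obtain ⟨a', ha', I, hI', hId⟩ := hρM ε ⟨hε, hε'.1⟩
      -- By uniqueness the image found for tolerance `η` is the image `A ε` already fixed.
      rw [hunique ε _ _ ha' (hA ε ⟨hε, hε'.2⟩)] at hI'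
      simpa [h, hI'] using hId

end NearHamiltonian

/-! ### The theorem: signs at the vertices and summation over the arcs. -/

open NearHamiltonian in
theorem theorem2p1 {d m : ℕ}
    (H : NearHamiltonian.Phase d → ℝ) (hH : ContDiff ℝ ∞ H)
    (D : Set (Fin m → ℝ)) (hD : IsCompact D)
    (g : Fin 4 → NearHamiltonian.Phase d → (Fin m → ℝ) → NearHamiltonian.Phase d)
    (hg : ∀ k, ∀ δ ∈ D, ContDiff ℝ ∞ (fun x => g k x δ))
    (G₁ : Set (Fin d → ℝ)) (J : (Fin d → ℝ) → Set ℝ)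
    (V : Fin 4 → ℝ → (Fin d → ℝ) → ℝ × ℝ)
    (hH1 : NearHamiltonian.HypH1 H G₁ J V) (hH2 : NearHamiltonian.HypH2 H G₁ J V)
    (hhat : Fin d → ℝ) (hhat_mem : hhat ∈ G₁) (h₁ : ℝ) (h₁_mem : h₁ ∈ J hhat)
    (δ : Fin m → ℝ) (hδ : δ ∈ D)
    (T : Fin 4 → ℝ) (γ : Fin 4 → ℝ → ℝ × ℝ)
    (harc : ∀ k, NearHamiltonian.IsOrbitalArc H h₁ hhat k (V k h₁ hhat) (V (k + 1) h₁ hhat)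
      (T k) (γ k)) :
    NearHamiltonian.IsMelnikovVector H (fun k x => g k x δ)
      ((V 0 h₁ hhat).1, (V 0 h₁ hhat).2, hhat)
      (∑ k, (NearHamiltonian.M1 (fun x => g k x δ) hhat (T k) (γ k) +
          NearHamiltonian.N H (fun x => g k x δ) hhat (T k) (γ k)),
        fun i => ∑ k, NearHamiltonian.Mj (fun x => g k x δ) hhat i (T k) (γ k)) := by
  have hg1 : ∀ k, ContDiff ℝ 1 (fun x => g k x δ) := fun k => (hg k δ hδ).of_le (by norm_cast)
  have hA := hH1.vertexA hhat hhat_mem h₁ h₁_mem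
  have hB := hH1.vertexB hhat hhat_mem h₁ h₁_mem
  have hC := hH1.vertexC hhat hhat_mem h₁ h₁_mem
  have hE := hH1.vertexE hhat hhat_mem h₁ h₁_mem
  have hprod := hH2 hhat hhat_mem h₁ h₁_mem
  simp only [mul_ne_zero_iff] at hprod
  obtain ⟨⟨⟨hAt, hCt⟩, hBt⟩, hEt⟩ := hprod
  set P : Fin 4 → Phase d := fun k => ((V k h₁ hhat).1, (V k h₁ hhat).2, hhat) with hPdef
  have hexit : ∀ k, 0 < exitFunctional k (P k) := fun k => by
    fin_cases k <;> simp [exitFunctional, hPdef, hA, hB, hC, hE]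
  have hentry : ∀ k, entryFunctional k (P k) = 0 := fun k => by
    fin_cases k <;> simp [entryFunctional, exitFunctional, hPdef, hA, hB, hC, hE]
  have hentry' : ∀ k, 0 < entryFunctional k (P (k + 1)) := fun k => by
    fin_cases k <;> simp [entryFunctional, exitFunctional, hPdef, hA, hB, hC, hE]
  have hexit' : ∀ k, exitFunctional k (P (k + 1)) = 0 := fun k => by
    simpa [entryFunctional_succ] using hentry (k + 1)
  -- At `ε = 0` the perturbation drops out, leaving, up to sign, `H_{x₂}` at `A`, `C` and `H_{x₁}`
  -- at `B`, `E`: the factors in (H2).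
  have htrans : ∀ k g', entryFunctional k (vectorField H g' 0 (P k)) ≠ 0 := fun k g' => by
    fin_cases k <;> simpa [entryFunctional, exitFunctional, hPdef, vectorField]
  have htrans' : ∀ k g', exitFunctional k (vectorField H g' 0 (P (k + 1))) ≠ 0 := fun k g' => by
    simpa [entryFunctional_succ] using htrans (k + 1) g'
  refine isMelnikovVector_of_forall_near
    (fun ε a' a'' => isPoincareImage_unique hH hg1) fun η hη => ?_
  have hM : (∑ k, (M1 (fun x => g k x δ) hhat (T k) (γ k) +
      N H (fun x => g k x δ) hhat (T k) (γ k)),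
      fun i => ∑ k, Mj (fun x => g k x δ) hhat i (T k) (γ k)) =
      ∑ k, ((M1 (fun x => g k x δ) hhat (T k) (γ k) + N H (fun x => g k x δ) hhat (T k) (γ k),
        fun i => Mj (fun x => g k x δ) hhat i (T k) (γ k)) : ℝ × (Fin d → ℝ)) := by
    refine Prod.ext ?_ ?_
    · simp [Prod.fst_sum]
    · ext i
      simp [Prod.snd_sum, Finset.sum_apply]
  rw [hM]
  exact exists_isPoincareImage_near (hentry 0) (fun k η hη =>
    (harc k).exists_isFirstHit_near hH (g := fun k x => g k x δ) (hg1 k) (hexit k) (hentry k)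
      (htrans k _) (hexit' k) (hentry' k) (htrans' k _) hη) hη
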